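/- Let $\Sigma$ be an alphabet and let $x\in\Sigma^*$ be a string of length $N$; let $M$ be the merge count. Consider the following implementation of greedy byte-pair encoding. The string is stored as a doubly linked list of subwords, initially its characters. For every pair of subwords that occurs at neighbouring nodes, the set of its positions (in the order of insertion) is stored; the size of this set is the frequency of the pair. A priority queue built from binary heaps, with the frequency as key, holds the $M$ most frequent pairs; the remaining pairs are kept outside the heaps, in buckets by frequency. After initialization, the following is done $M$ times, or until no pair is left: take a most frequent pair $\mu$ out of the queue, and for each of its positions $(w_1,w_2)$, from left to right, that still is an occurrence of $\mu$: remove the positions $(w_1.\mathrm{prev},w_1)$ and $(w_2,w_2.\mathrm{next})$, replace $w_1,w_2$ by one node whose value is the pair of their values, and add the positions formed by this node with its left and its right neighbour; then append $\mu$ to the output merge sequence. Each removal or addition of a position updates the queue. The running time is the number of elementary operations, where reading or writing one list node or one cell of a heap array, one access to a dictionary indexed by pairs of subwords, and one insertion into or deletion from a set each count as one. Then: 1. the total number of applications of merges at single positions, over all iterations, is at most $N-1$ (and is $0$ if $N=0$); 2. the algorithm runs in $O(N\log M)$ time: there is an absolute constant $C$ such that for every alphabet, every string of length $N\ge 1$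 and every $M\ge 2$, the number of elementary operations is at most $C\,N\log M$. -/

import Mathlib

/-- The set `Υ_Σ` of merges over an alphabet `α`: the characters (trivial merges), closed under
pairing. These are also the values of the nodes of the tokenized string. -/
inductive Merge (α : Type) where
  | char (a : α) : Merge α
  | pair (l r : Merge α) : Merge α
  deriving DecidableEq

/-- A pair of adjacent values, i.e. a possible merge. -/
abbrev MPair (α : Type) := Merge α × Merge α

/-- A node of the doubly linked list of subwords; nodes are addressed by natural numbers. -/
structure LNode (α : Type) where
  val : Merge α
  prev : Option ℕ
  next : Option ℕ

/-- The priority queue has to find both its largest entry (the next merge) and its smallest entry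
(the one that leaves when a more frequent pair enters a full queue). It is kept as two binary heaps with the same entries,
a max-heap and a min-heap. -/
inductive Side where
  | max
  | min
  deriving DecidableEq

/-- The memory of the machine, with two counters. -/
structure Machine (α : Type) where
  /-- the linked list: the node at each address (`none`: no node) -/
  node : ℕ → Option (LNode α)
  /-- for each pair, the set of the positions where it occurs, in the order of insertion; a
  position `(w₁, w₂)` is given by the address of its left node `w₁` -/
  positions : MPair α → List ℕ
  /-- the arrays of the two binary heaps -/
  heap : Side → Array (MPair α)
  /-- for each pair, its index in the array of the heap (`none`: not in the heap) -/
  slot : Side → MPair α → Option ℕ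
  /-- the pairs that occur but are not in the heaps, in buckets by frequency -/
  bucket : ℕ → List (MPair α)
  /-- a bound for the indices of the nonempty buckets -/
  bound : ℕ
  /-- the merge sequence that has been output -/
  out : List (Merge α)
  /-- how many times a merge has been applied at one position -/
  applied : ℕ
  /-- how many elementary operations have been executed -/
  steps : ℕ

/-- Programs over the machine. They touch the memory only by the elementary operations below. -/
abbrev Prog (α : Type) := StateM (Machine α)

namespace Machine

variable {α : Type} [DecidableEq α]

/-- The empty memory. -/
def empty : Machine α where
  node _ := none
  positions _ := []
  heap _ := #[]
  slot _ _ := none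
  bucket _ := []
  bound := 0
  out := []
  applied := 0
  steps := 0

/-! ### Elementary operations, each of which takes one step

Access to one node of the list, to one cell of an array, one lookup or update in a dictionary whose
keys are pairs of subwords, one insertion into or deletion from a set (of positions, or a bucket of
pairs), and one formation of a pair of subwords take constant time; so do comparisons of subwords
and of numbers. -/

/-- An elementary operation: act on the memory and count one step. -/
def elementary {β : Type} (f : Machine α → β × Machine α) : Prog α β :=
  modifyGet fun s => ((f s).1, { (f s).2 with steps := s.steps + 1 })

def readNode (w : ℕ) : Prog α (Option (LNode α)) :=
  elementary fun s => (s.node w, s)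

def writeNode (w : ℕ) (n : Option (LNode α)) : Prog α Unit :=
  elementary fun s => ((), { s with node := Function.update s.node w n })

/-- The number of positions of a pair, that is, its frequency. -/
def frequency (p : MPair α) : Prog α ℕ :=
  elementary fun s => ((s.positions p).length, s)

def insertPos (p : MPair α) (w : ℕ) : Prog α Unit :=
  elementary fun s =>
    ((), { s with positions := Function.update s.positions p (s.positions p ++ [w]) })

def erasePos (p : MPair α) (w : ℕ) : Prog α Unit :=
  elementary fun s =>
    ((), { s with positions := Function.update s.positions p ((s.positions p).erase w) })

/-- Detach the set of positions of a pair; the elements are visited one by one later on. -/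
def takePos (p : MPair α) : Prog α (List ℕ) :=
  elementary fun s => (s.positions p, { s with positions := Function.update s.positions p [] })

def heapSize (d : Side) : Prog α ℕ :=
  elementary fun s => ((s.heap d).size, s)

def readCell (d : Side) (i : ℕ) : Prog α (Option (MPair α)) :=
  elementary fun s => ((s.heap d)[i]?, s)

def writeCell (d : Side) (i : ℕ) (p : MPair α) : Prog α Unit :=
  elementary fun s =>
    ((), { s with heap := Function.update s.heap d ((s.heap d).setIfInBounds i p) })

/-- Extend the array by one cell. -/
def pushCell (d : Side) (p : MPair α) : Prog α Unit :=
  elementary fun s => ((), { s with heap := Function.update s.heap d ((s.heap d).push p) })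

/-- Drop the last cell of the array. -/
def popCell (d : Side) : Prog α Unit :=
  elementary fun s => ((), { s with heap := Function.update s.heap d (s.heap d).pop })

def readSlot (d : Side) (p : MPair α) : Prog α (Option ℕ) :=
  elementary fun s => (s.slot d p, s)

def writeSlot (d : Side) (p : MPair α) (i : Option ℕ) : Prog α Unit :=
  elementary fun s =>
    ((), { s with slot := Function.update s.slot d (Function.update (s.slot d) p i) })

def bucketInsert (f : ℕ) (p : MPair α) : Prog α Unit :=
  elementary fun s => ((), { s with bucket := Function.update s.bucket f (p :: s.bucket f) })

def bucketErase (f : ℕ) (p : MPair α) : Prog α Unit :=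
  elementary fun s => ((), { s with bucket := Function.update s.bucket f ((s.bucket f).erase p) })

/-- Some pair of a bucket, if there is one. -/
def bucketHead (f : ℕ) : Prog α (Option (MPair α)) :=
  elementary fun s => ((s.bucket f).head?, s)

def readBound : Prog α ℕ :=
  elementary fun s => (s.bound, s)

def writeBound (r : ℕ) : Prog α Unit :=
  elementary fun s => ((), { s with bound := r })

/-- Append a merge to the output. -/
def emit (m : Merge α) : Prog α Unit :=
  elementary fun s => ((), { s with out := s.out ++ [m] })

/-- Bookkeeping for the statement, not a step of the algorithm: record that a merge has been applied
at one position. -/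
def countApplication : Prog α Unit :=
  modify fun s => { s with applied := s.applied + 1 }

/-! ### The binary heaps, ordered by frequency -/

/-- Does the pair in cell `i` belong strictly above the pair in cell `j`? -/
def above (d : Side) (i j : ℕ) : Prog α Bool := do
  match ← readCell d i, ← readCell d j with
  | some p, some q =>
    let a ← frequency p
    let b ← frequency q
    match d with
    | .max => return decide (b < a)
    | .min => return decide (a < b)
  | _, _ => return false

/-- Exchange two cells. -/
def swapCells (d : Side) (i j : ℕ) : Prog α Unit := do
  match ← readCell d i, ← readCell d j with
  | some p, some q =>
    writeCell d i q
    writeCell d j p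
    writeSlot d p (some j)
    writeSlot d q (some i)
  | _, _ => return ()

def siftUp (d : Side) (i : ℕ) : Prog α Unit :=
  if _h : i = 0 then return ()
  else do
    if ← above d i ((i - 1) / 2) then
      swapCells d i ((i - 1) / 2)
      siftUp d ((i - 1) / 2)
termination_by i
decreasing_by omega

/-- Sift down from cell `i` in a heap of size `n`. -/
def siftDown (d : Side) (n i : ℕ) : Prog α Unit :=
  if _h : 2 * i + 1 < n then do
    let b ← above d (2 * i + 2) (2 * i + 1)
    let c := 2 * i + 1 + b.toNat
    if ← above d c i then
      swapCells d i c
      siftDown d n c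
  else return ()
termination_by n - i
decreasing_by omega

/-- Restore the heap order after a change of the frequency of the pair in cell `i`. -/
def restore (d : Side) (i : ℕ) : Prog α Unit := do
  siftUp d i
  siftDown d (← heapSize d) i

/-- Insert a pair into a heap of capacity `M`; a full heap is left as it is. -/
def heapInsert (M : ℕ) (d : Side) (p : MPair α) : Prog α Unit := do
  let n ← heapSize d
  if n < M then
    pushCell d p
    writeSlot d p (some n)
    siftUp d n

/-- Delete a pair from a heap, if it is there. -/
def heapDelete (d : Side) (p : MPair α) : Prog α Unit := do
  match ← readSlot d p with
  | none => return ()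
  | some i =>
    let n ← heapSize d
    swapCells d i (n - 1)
    popCell d
    writeSlot d p none
    restore d i

/-! ### The priority queue

The heaps hold only the top `M` pairs. All other pairs that occur wait in the buckets; they are not
ordered beyond that. -/

/-- Find a most frequent pair outside the heaps, and its frequency, going down from bucket `r`. -/
def bestOutside : ℕ → Prog α (Option (MPair α × ℕ))
  | 0 => do
    writeBound 0
    return none
  | r + 1 => do
    match ← bucketHead (r + 1) with
    | some p =>
      writeBound (r + 1)
      return some (p, r + 1)
    | none => bestOutside r

/-- Move a pair of frequency `f` from its bucket into the heaps. -/
def promote (M : ℕ) (p : MPair α) (f : ℕ) : Prog α Unit := do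
  bucketErase f p
  heapInsert M .max p
  heapInsert M .min p

/-- After one change, make the heaps hold the top `M` pairs again: a most frequent pair outside
enters if there is room, or if it is more frequent than a least frequent pair of the heaps, which
then leaves. -/
def balance (M : ℕ) : Prog α Unit := do
  match ← bestOutside (← readBound) with
  | none => return ()
  | some (p, f) =>
    if (← heapSize .max) < M then
      promote M p f
    else
      match ← readCell .min 0 with
      | none => return ()
      | some q =>
        let g ← frequency q
        if g < f then
          heapDelete .max q
          heapDelete .min q
          bucketInsert g q
          promote M p f

/-- The frequency of a pair has changed from `f` to `g`: move the pair to its new place (a pair that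
no longer occurs is dropped). -/
def move (M : ℕ) (p : MPair α) (f g : ℕ) : Prog α Unit := do
  match ← readSlot .max p, ← readSlot .min p with
  | some i, some j =>
    if g = 0 then
      heapDelete .max p
      heapDelete .min p
    else
      restore .max i
      restore .min j
  | _, _ =>
    bucketErase f p
    if g ≠ 0 then
      bucketInsert g p
      if (← readBound) < g then writeBound g
  balance M

/-- `AddPosition`: the nodes `u`, `v` have become neighbours (nothing to do at an end of the list). -/
def addPosition (M : ℕ) : Option ℕ → Option ℕ → Prog α Unit
  | some u, some v => do
    match ← readNode u, ← readNode v with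
    | some a, some b =>
      let f ← frequency (a.val, b.val)
      insertPos (a.val, b.val) u
      move M (a.val, b.val) f (← frequency (a.val, b.val))
    | _, _ => return ()
  | _, _ => return ()

/-- `RemovePosition`: the nodes `u`, `v` cease to be neighbours (nothing to do at an end of the
list). -/
def removePosition (M : ℕ) : Option ℕ → Option ℕ → Prog α Unit
  | some u, some v => do
    match ← readNode u, ← readNode v with
    | some a, some b =>
      let f ← frequency (a.val, b.val)
      erasePos (a.val, b.val) u
      move M (a.val, b.val) f (← frequency (a.val, b.val))
    | _, _ => return ()
  | _, _ => return ()

/-- Take a most frequent pair out of the queue, with its positions. -/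
def top (M : ℕ) : Prog α (Option (MPair α × List ℕ)) := do
  match ← readCell .max 0 with
  | none => return none
  | some p =>
    heapDelete .max p
    heapDelete .min p
    let pos ← takePos p
    balance M
    return some (p, pos)

/-! ### Greedy byte-pair encoding -/

/-- `LinkedList(x)`: the characters `x` get the addresses `i`, `i + 1`, … -/
def buildList : ℕ → List α → Prog α Unit
  | _, [] => return ()
  | i, a :: x => do
    writeNode i (some
      { val := .char a
        prev := if i = 0 then none else some (i - 1)
        next := if x.isEmpty then none else some (i + 1) })
    buildList (i + 1) x

/-- `MaxHeap(Pairs(x))` for a list with `n` nodes at the addresses `0, …, n - 1`. -/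
def buildHeap (M n : ℕ) : Prog α Unit :=
  (List.range (n - 1)).forM fun i => addPosition M (some i) (some (i + 1))

/-- The body of the inner loop: apply the merge `p` at the position whose left node is `w₁`. The test
fails if the position was destroyed before in the same loop, by a merge at an overlapping
position (as in `aaa`); then the position is skipped. -/
def applyAt (M : ℕ) (p : MPair α) (w₁ : ℕ) : Prog α Unit := do
  let some a ← readNode w₁ | return ()
  let some w₂ := a.next | return ()
  let some b ← readNode w₂ | return ()
  if (a.val, b.val) = p then
    countApplication
    removePosition M a.prev (some w₁)
    removePosition M (some w₂) b.next
    writeNode w₁ (some { val := .pair a.val b.val, prev := a.prev, next := b.next })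
    writeNode w₂ none
    if let some w₃ := b.next then
      if let some c ← readNode w₃ then
        writeNode w₃ (some { c with prev := some w₁ })
    addPosition M a.prev (some w₁)
    addPosition M (some w₁) b.next

/-- The outer loop, with `k` iterations to go; it ends early when no pair is left. -/
def mainLoop (M : ℕ) : ℕ → Prog α Unit
  | 0 => return ()
  | k + 1 => do
    match ← top M with
    | some (p, w :: ws) =>
      (w :: ws).forM (applyAt M p)
      emit (.pair p.1 p.2)
      mainLoop M k
    | _ => return ()

/-- The whole algorithm on the string `x` with merge count `M`. The tokenized string is left in the
linked list (its first node is at address `0`), the merge sequence in `out`. -/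
def fasterBPE (M : ℕ) (x : List α) : Prog α Unit := do
  buildList 0 x
  buildHeap M x.length
  mainLoop M M

/-- The final memory of the run on the string `x` with merge count `M`, from the empty memory. -/
def run (M : ℕ) (x : List α) : Machine α :=
  (StateT.run (fasterBPE M x) empty).2

end Machine

/-! Part 1: every application of a merge deletes one of the two nodes it joins and keeps the other.
Hence "number of nodes + number of applications" stays equal to `N`, and for `N ≥ 1` a node always
remains. Addresses increase along the `next` pointers, so the two nodes are really distinct
(`ListInv`, `applyAt_listInv`).

Part 2, cost of one queue operation: a heap has at most `M ≤ 2 ^ L` cells, so sifting takes `O(L)`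
steps. Neither the heap order nor the correctness of the chosen maximum matters for this; it
suffices that the slots invert the arrays (`Indexed`) and that each pair outside the heaps lies in
the right bucket (`QueueInv`). The scan for the best bucket can be long, but every empty bucket it
passes lowers `bound` by one, while a change of one position raises `bound` by at most one. So with
the potential `bound`, adding or removing a position and taking the top each cost at most `K = 116 *
L + 75` (`balance_after`, `move_after`).

Part 2, number of operations: an application makes four queue operations and creates at most two
positions. Iterations and skipped positions are charged to the positions themselves: each stored
position carries `K + 3` credits. An iteration that continues detaches at least one position, and
the released credits pay for the top (`K`), for the visits that skip a position (2 each) and for the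
output (1). Thus the number of iterations does not enter the bound (`mainLoop_account`). With at
most `N` applications and `N - 1` initial positions the total is `O(N * K)`, which is `O(N log M)`
for `M ≥ 2`. -/

set_option linter.unusedSectionVars false

namespace Machine

/-! ### Reasoning about programs -/

section Programs

variable {α β γ δ : Type}

/-- The postcondition `Q` holds for the result and the final memory of `c`, started in `s`. -/
def After (c : Prog α β) (s : Machine α) (Q : β → Machine α → Prop) : Prop :=
  Q (StateT.run c s).1 (StateT.run c s).2

theorem After.mono {c : Prog α β} {s : Machine α} {P Q : β → Machine α → Prop}
    (h : After c s P) (hPQ : ∀ b t, P b t → Q b t) : After c s Q :=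
  hPQ _ _ h

theorem After.and {c : Prog α β} {s : Machine α} {P Q : β → Machine α → Prop}
    (h : After c s P) (h' : After c s Q) : After c s fun b t => P b t ∧ Q b t :=
  ⟨h, h'⟩

theorem after_bind {c : Prog α β} {k : β → Prog α γ} {s : Machine α}
    {Q : γ → Machine α → Prop} :
    After (c >>= k) s Q ↔ After c s fun b t => After (k b) t Q := Iff.rfl

theorem after_pure {b : β} {s : Machine α} {Q : β → Machine α → Prop} :
    After (pure b : Prog α β) s Q ↔ Q b s := Iff.rfl

theorem after_elementary {f : Machine α → β × Machine α} {s : Machine α}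
    {Q : β → Machine α → Prop} :
    After (elementary f) s Q ↔ Q (f s).1 { (f s).2 with steps := s.steps + 1 } := Iff.rfl

theorem after_countApplication {s : Machine α} {Q : Unit → Machine α → Prop} :
    After (countApplication : Prog α Unit) s Q ↔
      Q () { s with applied := s.applied + 1 } := Iff.rfl

/-- The program `c` does not change the part `f` of the memory. -/
def Keeps (f : Machine α → δ) (c : Prog α β) : Prop :=
  ∀ s, After c s fun _ t => f t = f s

variable {f : Machine α → δ}

theorem Keeps.bind {c : Prog α β} {k : β → Prog α γ} (hc : Keeps f c) (hk : ∀ b, Keeps f (k b)) :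
    Keeps f (c >>= k) := fun s =>
  (hk _ _).trans (hc s)

theorem Keeps.pure (b : β) : Keeps f (pure b : Prog α β) := fun _ => rfl

theorem Keeps.comp {ε : Type} {c : Prog α β} (h : Keeps f c) (g : δ → ε) :
    Keeps (fun s => g (f s)) c :=
  fun s => congrArg g (h s)

theorem Keeps.ite {c c' : Prog α β} {p : Prop} [Decidable p] (h : Keeps f c) (h' : Keeps f c') :
    Keeps f (if p then c else c') := by
  split <;> assumption

end Programs

end Machine

/-- The other one of the two heaps. -/
def Side.other : Side → Side
  | .max => .min
  | .min => .max

namespace Machine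

variable {α : Type} [DecidableEq α]

/-! ### What the operations leave unchanged -/

/-- The part of the memory that is not changed by the operations on the heap `d`. -/
def outsideHeap (d : Side) (s : Machine α) :=
  (s.node, s.positions, s.bucket, s.bound, s.applied, s.heap d.other, s.slot d.other)

/-- The part of the memory that is not changed by the operations on the priority queue. -/
def outsideQueue (s : Machine α) := (s.node, s.positions, s.applied)

theorem above_keeps (d e : Side) (i j : ℕ) : Keeps (outsideHeap (α := α) d) (above e i j) := by
  unfold above
  refine .bind (fun _ => rfl) fun p => .bind (fun _ => rfl) fun q => ?_
  split
  · refine .bind (fun _ => rfl) fun p => .bind (fun _ => rfl) fun q => ?_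
    cases e <;> exact .pure _
  · exact .pure _

theorem writeCell_keeps (d : Side) (i : ℕ) (p : MPair α) :
    Keeps (outsideHeap d) (writeCell d i p) := fun _ => by cases d <;> rfl

theorem writeSlot_keeps (d : Side) (p : MPair α) (i : Option ℕ) :
    Keeps (outsideHeap d) (writeSlot d p i) := fun _ => by cases d <;> rfl

theorem swapCells_keeps (d : Side) (i j : ℕ) :
    Keeps (outsideHeap (α := α) d) (swapCells d i j) := by
  unfold swapCells
  refine .bind (fun _ => rfl) fun p => .bind (fun _ => rfl) fun q => ?_
  split
  · exact .bind (writeCell_keeps _ _ _) fun _ => .bind (writeCell_keeps _ _ _) fun _ =>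
      .bind (writeSlot_keeps _ _ _) fun _ => writeSlot_keeps _ _ _
  · exact .pure _

theorem siftUp_keeps (d : Side) (i : ℕ) : Keeps (outsideHeap (α := α) d) (siftUp d i) := by
  induction i using Nat.strong_induction_on with
  | _ i ih =>
    unfold siftUp
    split
    · exact .pure _
    · refine .bind (above_keeps _ _ _ _) fun b => .ite ?_ (.pure _)
      exact .bind (swapCells_keeps _ _ _) fun _ => ih _ (by omega)

theorem siftDown_keeps (d : Side) (n i : ℕ) :
    Keeps (outsideHeap (α := α) d) (siftDown d n i) := by
  induction h : n - i using Nat.strong_induction_on generalizing i with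
  | _ k ih =>
    unfold siftDown
    split
    · refine .bind (above_keeps _ _ _ _) fun b => .bind (above_keeps _ _ _ _) fun b' =>
        .ite ?_ (.pure _)
      exact .bind (swapCells_keeps _ _ _) fun _ => ih _ (by omega) _ rfl
    · exact .pure _

theorem restore_keeps (d : Side) (i : ℕ) : Keeps (outsideHeap (α := α) d) (restore d i) :=
  .bind (siftUp_keeps _ _) fun _ => .bind (fun _ => rfl) fun _ => siftDown_keeps _ _ _

theorem heapInsert_keeps (M : ℕ) (d : Side) (p : MPair α) :
    Keeps (outsideHeap d) (heapInsert M d p) := by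
  refine .bind (fun _ => rfl) fun n => .ite ?_ (.pure _)
  exact .bind (fun _ => by cases d <;> rfl) fun _ => .bind (writeSlot_keeps _ _ _) fun _ =>
    siftUp_keeps _ _

theorem heapDelete_keeps (d : Side) (p : MPair α) : Keeps (outsideHeap d) (heapDelete d p) := by
  refine .bind (fun _ => rfl) fun n => ?_
  split
  · exact .pure _
  · exact .bind (fun _ => rfl) fun _ => .bind (swapCells_keeps _ _ _) fun _ =>
      .bind (fun _ => by cases d <;> rfl) fun _ => .bind (writeSlot_keeps _ _ _) fun _ =>
      restore_keeps _ _

theorem Keeps.queue {β : Type} {d : Side} {c : Prog α β} (h : Keeps (outsideHeap d) c) :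
    Keeps outsideQueue c :=
  h.comp fun x => (x.1, x.2.1, x.2.2.2.2.1)

theorem bestOutside_keeps (r : ℕ) : Keeps (outsideQueue (α := α)) (bestOutside r) := by
  induction r with
  | zero => exact .bind (fun _ => rfl) fun _ => .pure _
  | succ r ih =>
    refine .bind (fun _ => rfl) fun o => ?_
    cases o
    · exact ih
    · exact .bind (fun _ => rfl) fun _ => .pure _

theorem promote_keeps (M : ℕ) (p : MPair α) (k : ℕ) :
    Keeps outsideQueue (promote M p k) :=
  .bind (fun _ => rfl) fun _ => .bind (heapInsert_keeps _ _ _).queue fun _ =>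
    (heapInsert_keeps _ _ _).queue

theorem balance_keeps (M : ℕ) : Keeps (outsideQueue (α := α)) (balance M) := by
  refine .bind (fun _ => rfl) fun r => .bind (bestOutside_keeps r) fun o => ?_
  split
  · exact .pure _
  · refine .bind (fun _ => rfl) fun _ => .ite (promote_keeps _ _ _) (.bind (fun _ => rfl) fun o => ?_)
    split
    · exact .pure _
    · refine .bind (fun _ => rfl) fun _ => .ite ?_ (.pure _)
      exact .bind (heapDelete_keeps _ _).queue fun _ =>
        .bind (heapDelete_keeps _ _).queue fun _ =>
        .bind (fun _ => rfl) fun _ => promote_keeps _ _ _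

theorem move_keeps (M : ℕ) (p : MPair α) (k l : ℕ) : Keeps outsideQueue (move M p k l) := by
  refine .bind (fun _ => rfl) fun o => .bind (fun _ => rfl) fun o' => ?_
  split
  · refine .ite ?_ ?_
    · exact .bind (heapDelete_keeps _ _).queue fun _ =>
        .bind (heapDelete_keeps _ _).queue fun _ => balance_keeps _
    · exact .bind (restore_keeps _ _).queue fun _ =>
        .bind (restore_keeps _ _).queue fun _ => balance_keeps _
  · refine .bind (fun _ => rfl) fun _ => .ite ?_ (balance_keeps _)
    refine .bind (fun _ => rfl) fun _ => .bind (fun _ => rfl) fun _ => .ite ?_ (balance_keeps _)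
    exact .bind (fun _ => rfl) fun _ => balance_keeps _

/-- The linked list and the number of applications. -/
def listPart (s : Machine α) := (s.node, s.applied)

theorem Keeps.list {β : Type} {c : Prog α β} (h : Keeps outsideQueue c) : Keeps listPart c :=
  h.comp fun x => (x.1, x.2.2)

theorem addPosition_keeps (M : ℕ) (u v : Option ℕ) :
    Keeps (listPart (α := α)) (addPosition M u v) := by
  unfold addPosition
  split
  · refine .bind (fun _ => rfl) fun o => .bind (fun _ => rfl) fun o' => ?_
    split
    · exact .bind (fun _ => rfl) fun _ => .bind (fun _ => rfl) fun _ =>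
        .bind (fun _ => rfl) fun _ => (move_keeps _ _ _ _).list
    · exact .pure _
  · exact .pure _

theorem removePosition_keeps (M : ℕ) (u v : Option ℕ) :
    Keeps (listPart (α := α)) (removePosition M u v) := by
  unfold removePosition
  split
  · refine .bind (fun _ => rfl) fun o => .bind (fun _ => rfl) fun o' => ?_
    split
    · exact .bind (fun _ => rfl) fun _ => .bind (fun _ => rfl) fun _ =>
        .bind (fun _ => rfl) fun _ => (move_keeps _ _ _ _).list
    · exact .pure _
  · exact .pure _

theorem top_keeps (M : ℕ) : Keeps (listPart (α := α)) (top M) := by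
  refine .bind (fun _ => rfl) fun o => ?_
  split
  · exact .pure _
  · exact .bind (heapDelete_keeps _ _).queue.list fun _ =>
      .bind (heapDelete_keeps _ _).queue.list fun _ =>
      .bind (fun _ => rfl) fun _ => .bind (balance_keeps _).list fun _ => .pure _

/-! ### The number of applications -/

theorem Keeps.after_bind {β γ δ : Type} {f : Machine α → δ} {c : Prog α β} {k : β → Prog α γ}
    {s : Machine α} {Q : γ → Machine α → Prop} (hc : Keeps f c)
    (hk : ∀ b t, f t = f s → After (k b) t Q) : After (c >>= k) s Q :=
  hk _ _ (hc s)

/-- The nodes of the list and the applications together number `N`, at least one node remains, and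
the addresses increase along the list. -/
structure ListInv (N : ℕ) (x : (ℕ → Option (LNode α)) × ℕ) : Prop where
  count : ∃ F : Finset ℕ, (∀ w, (x.1 w).isSome ↔ w ∈ F) ∧ F.card + x.2 = N ∧ (1 ≤ N → 1 ≤ F.card)
  lt_next : ∀ w a v, x.1 w = some a → a.next = some v → w < v

theorem ListInv.writeNode {N m : ℕ} {g : ℕ → Option (LNode α)} (h : ListInv N (g, m)) {w : ℕ}
    {a b : LNode α} (hw : g w = some a) (hb : ∀ v, b.next = some v → w < v) :
    ListInv N (Function.update g w (some b), m) := by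
  obtain ⟨⟨F, hF, hN, h1⟩, hlt⟩ := h
  refine ⟨⟨F, fun v => ?_, hN, h1⟩, fun v c u hc hu => ?_⟩
  · by_cases hv : v = w
    · subst hv
      simp [← hF v, hw]
    · simp [Function.update_of_ne hv, ← hF v]
  · by_cases hv : v = w
    · subst hv
      simp only [Function.update_self, Option.some.injEq] at hc
      subst hc
      exact hb _ hu
    · simp only [Function.update_of_ne hv] at hc
      exact hlt _ _ _ hc hu

/-- The lost node is balanced by the increment of the application count; the distinct node `w`
witnesses that the list does not become empty. -/
theorem ListInv.eraseNode {N m : ℕ} {g : ℕ → Option (LNode α)} (h : ListInv N (g, m)) {w v : ℕ}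
    (hw : (g w).isSome) (hv : (g v).isSome) (hwv : w ≠ v) :
    ListInv N (Function.update g v none, m + 1) := by
  obtain ⟨⟨F, hF, hN, h1⟩, hlt⟩ := h
  simp only at hF hN hlt
  have hvF := (hF v).1 hv
  have hwF : w ∈ F.erase v := Finset.mem_erase.2 ⟨hwv, (hF w).1 hw⟩
  refine ⟨⟨F.erase v, fun u => ?_, ?_, fun _ => Finset.card_pos.2 ⟨w, hwF⟩⟩,
    fun u c z hc hz => ?_⟩
  · by_cases hu : u = v
    · subst hu
      simp
    · simp [hF u, hu]
  · have := Finset.card_erase_add_one hvF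
    simp only
    omega
  · by_cases hu : u = v
    · subst hu
      simp at hc
    · simp only [Function.update_of_ne hu] at hc
      exact hlt _ _ _ hc hz

/-- Queue operations leave the list alone, so only the node updates matter. Increasing addresses
give `w < v`, so `w` survives the deletion of `v`; by transitivity the new successor of `w` still
has a larger address. -/
theorem applyAt_listInv {N : ℕ} (M : ℕ) (p : MPair α) (w : ℕ) {s : Machine α}
    (hs : ListInv N (listPart s)) :
    After (applyAt M p w) s fun _ t => ListInv N (listPart t) := by
  have hadd (u v u' v' : Option ℕ) (t : Machine α) (ht : ListInv N (listPart t)) :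
      After (addPosition M u v >>= fun _ => addPosition M u' v') t
        fun _ t => ListInv N (listPart t) :=
    (addPosition_keeps M u v).after_bind fun _ t₁ h₁ =>
      (addPosition_keeps M u' v' t₁).mono fun _ t₂ h₂ => by rwa [h₂, h₁]
  unfold applyAt
  rw [after_bind]
  simp only [readNode, after_elementary]
  split
  next a ha =>
    split
    next v hv =>
      simp only [after_bind, after_elementary]
      split
      next b hb =>
        split
        · have hwv := hs.lt_next w a v ha hv
          rw [after_bind, after_countApplication]
          refine (removePosition_keeps (α := α) M _ _).after_bind fun _ s₁ h₁ =>
            (removePosition_keeps (α := α) M _ _).after_bind fun _ s₂ h₂ => ?_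
          replace h₂ : s₂.listPart = (s.node, s.applied + 1) := h₂.trans h₁
          simp only [listPart, Prod.mk.injEq] at h₂
          simp only [after_bind, Machine.writeNode, after_elementary, h₂.1]
          have hnew : ListInv N (Function.update (Function.update s.node w
              (some { val := a.val.pair b.val, prev := a.prev, next := b.next })) v none,
              s.applied + 1) := by
            refine ListInv.eraseNode (w := w) (hs.writeNode ha fun u hu => ?_) ?_ ?_ hwv.ne
            · exact hwv.trans (hs.lt_next v b u hb hu)
            · simp
            · rw [Function.update_of_ne hwv.ne']
              simp [hb]
          rw [← h₂.2] at hnew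
          split
          next z hz =>
            simp only [after_bind, after_elementary]
            split
            next c hc =>
              exact hadd _ _ _ _ _ (hnew.writeNode hc fun u hu => hnew.lt_next _ _ _ hc hu)
            · exact hadd _ _ _ _ _ hnew
          · exact hadd _ _ _ _ _ hnew
        · exact hs
      · exact hs
    · exact hs
  · exact hs

theorem After.bind {β γ : Type} {c : Prog α β} {k : β → Prog α γ} {s : Machine α}
    {P : β → Machine α → Prop} {Q : γ → Machine α → Prop} (hc : After c s P)
    (hk : ∀ b t, P b t → After (k b) t Q) : After (c >>= k) s Q :=
  hk _ _ hc

theorem after_forM {β : Type} {I : Machine α → Prop} {c : β → Prog α Unit} (l : List β)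
    (hc : ∀ b ∈ l, ∀ s, I s → After (c b) s fun _ t => I t) {s : Machine α} (hs : I s) :
    After (l.forM c) s fun _ t => I t := by
  induction l generalizing s with
  | nil => exact hs
  | cons b l ih =>
    change After (c b >>= fun _ => l.forM c) s _
    exact (hc b (by simp) s hs).bind fun _ t ht => ih (fun b' hb' => hc b' (by simp [hb'])) ht

theorem mainLoop_listInv {N : ℕ} (M k : ℕ) {s : Machine α} (hs : ListInv N (listPart s)) :
    After (mainLoop M k) s fun _ t => ListInv N (listPart t) := by
  induction k generalizing s with
  | zero => exact hs
  | succ k ih =>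
    refine (top_keeps M).after_bind fun o s₁ h₁ => ?_
    rw [← h₁] at hs
    split
    · exact (after_forM _ (fun w _ s hs => applyAt_listInv M _ w hs) hs).bind fun _ t ht => ih ht
    · exact hs

/-! ### The list after initialization, and the bound on the applications -/

theorem buildList_after (x : List α) (i : ℕ) (s : Machine α) :
    After (buildList i x) s fun _ t => t = { s with node := t.node, steps := s.steps + x.length } := by
  induction x generalizing i s with
  | nil => exact rfl
  | cons a x ih =>
    simp only [buildList, after_bind, Machine.writeNode, after_elementary]
    refine (ih _ _).mono fun _ t ht => ht.trans ?_
    simp only [List.length_cons, Machine.mk.injEq, true_and]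
    omega

theorem buildList_node (x : List α) (i : ℕ) {s : Machine α}
    (hs : ∀ w, (s.node w).isSome ↔ w ∈ Finset.range i)
    (hlt : ∀ w a v, s.node w = some a → a.next = some v → w < v) :
    After (buildList i x) s fun _ t => (∀ w, (t.node w).isSome ↔ w ∈ Finset.range (i + x.length)) ∧
      ∀ w a v, t.node w = some a → a.next = some v → w < v := by
  induction x generalizing i s with
  | nil => exact ⟨hs, hlt⟩
  | cons a x ih =>
    simp only [buildList, after_bind, Machine.writeNode, after_elementary]
    rw [List.length_cons, ← Nat.add_assoc, Nat.add_right_comm]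
    refine ih _ (fun w => ?_) fun w b v hb hv => ?_
    · by_cases hw : w = i
      · simp [hw]
      · simp only [Function.update_of_ne hw, hs, Finset.mem_range]
        omega
    · by_cases hw : w = i
      · subst hw
        simp only [Function.update_self, Option.some.injEq] at hb
        subst hb
        by_cases hx : x = [] <;> simp [hx] at hv
        omega
      · simp only [Function.update_of_ne hw] at hb
        exact hlt _ _ _ hb hv

theorem buildHeap_keeps (M n : ℕ) : Keeps (listPart (α := α)) (buildHeap M n) := fun _ =>
  after_forM _ (fun _ _ _ hs => (addPosition_keeps M _ _ _).mono fun _ _ h => h.trans hs) rfl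

theorem applied_run_le (M : ℕ) (x : List α) : (run M x).applied ≤ x.length - 1 := by
  have h : After (fasterBPE M x) empty fun _ t => ListInv x.length (listPart t) := by
    refine ((buildList_after x 0 empty).and (buildList_node x 0 (s := empty) ?_ ?_)).bind
      fun _ s₁ ⟨h₁, h₂, h₃⟩ => (buildHeap_keeps M _).after_bind fun _ s₂ h => ?_
    · simp [empty]
    · simp [empty]
    · refine mainLoop_listInv M M ?_
      rw [h]
      refine ⟨⟨Finset.range x.length, by simpa [listPart] using h₂, ?_, by simp⟩, h₃⟩
      rw [h₁]
      simp [listPart, empty]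
  obtain ⟨F, -, h₁, h₂⟩ := ListInv.count h
  change F.card + (run M x).applied = x.length at h₁
  -- For `N ≥ 1` the remaining node gives `N - 1`; for `N = 0` the sum itself forces zero
  -- applications, in agreement with truncated subtraction.
  omega

/-! ### The binary heaps -/

/-- The slots of the heap `d` are the indices of the pairs in its array. -/
def Indexed (d : Side) (s : Machine α) : Prop :=
  ∀ p i, s.slot d p = some i ↔ (s.heap d)[i]? = some p

/-- The memory `t` results from `s` by rearranging the heap `d` in at most `k` steps. -/
structure Rearranged (d : Side) (k : ℕ) (s t : Machine α) : Prop where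
  indexed : Indexed d t
  size : (t.heap d).size = (s.heap d).size
  isSome : ∀ p, (t.slot d p).isSome = (s.slot d p).isSome
  steps : t.steps ≤ s.steps + k

theorem Rearranged.trans {d : Side} {k l m : ℕ} {s t u : Machine α} (h : Rearranged d k s t)
    (h' : Rearranged d l t u) (hm : k + l ≤ m) : Rearranged d m s u :=
  ⟨h'.indexed, h'.size.trans h.size, fun p => (h'.isSome p).trans (h.isSome p), by
    have := h.steps
    have := h'.steps
    omega⟩

theorem Indexed.rearranged {d : Side} {s t : Machine α} {k : ℕ} (h : Indexed d s)
    (ht : t = { s with steps := t.steps }) (hk : t.steps ≤ s.steps + k) :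
    Rearranged d k s t := by
  rw [ht]
  exact ⟨h, rfl, fun _ => rfl, hk⟩

theorem Indexed.lt_size {d : Side} {s : Machine α} (h : Indexed d s) {p : MPair α} {i : ℕ}
    (hp : s.slot d p = some i) : i < (s.heap d).size :=
  (Array.getElem?_eq_some_iff.1 ((h p i).1 hp)).1

theorem above_after (d : Side) (i j : ℕ) (s : Machine α) :
    After (above d i j) s fun _ t => t = { s with steps := t.steps } ∧ t.steps ≤ s.steps + 4 := by
  simp only [above, after_bind, readCell, frequency, after_elementary]
  split
  · simp only [after_bind, after_elementary]
    cases d <;> simp only [after_pure, true_and] <;> omega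
  · simp only [after_pure, true_and]
    omega

/-- The case `i = j` is allowed. The second conjunct serves deletion, where the doomed pair must end
up in the last cell. -/
theorem swapCells_indexed {d : Side} {s : Machine α} (hs : Indexed d s) (i j : ℕ) :
    After (swapCells d i j) s fun _ t => Rearranged d 6 s t ∧
      ∀ p q, (s.heap d)[i]? = some p → (s.heap d)[j]? = some q → (t.heap d)[j]? = some p := by
  simp only [swapCells, after_bind, readCell, after_elementary]
  split
  next p q hp hq =>
    simp only [after_bind, writeCell, writeSlot, after_elementary, Function.update_self]
    have hi := (Array.getElem?_eq_some_iff.1 hp).1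
    have hj := (Array.getElem?_eq_some_iff.1 hq).1
    have hpi := (hs p i).2 hp
    have hqj := (hs q j).2 hq
    refine ⟨⟨fun r k => ?_, by simp, fun r => ?_, by simp⟩, fun p' q' hp' hq' => ?_⟩
    · have hr := hs r k
      simp only [Function.update_self, Array.getElem?_setIfInBounds, Array.size_setIfInBounds]
      by_cases hrq : r = q
      · subst hrq
        grind
      · by_cases hrp : r = p
        · subst hrp
          grind
        · grind
    · simp only [Function.update_self]
      by_cases hrq : r = q
      · simp [hrq, hqj]
      · by_cases hrp : r = p
        · simp [hrp, hpi]
          grind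
        · simp [hrp, hrq]
    · simp only [Array.getElem?_setIfInBounds, Array.size_setIfInBounds]
      grind
  next h =>
    simp only [after_pure]
    exact ⟨hs.rearranged rfl (by simp), fun p q hp hq => (h p q hp hq).elim⟩

/-- Passing to the parent halves the index; a level costs one comparison (4) and one exchange (6).
-/
theorem siftUp_rearranged {d : Side} {k i : ℕ} {s : Machine α} (hs : Indexed d s)
    (hi : i < 2 ^ k) : After (siftUp d i) s fun _ t => Rearranged d (10 * k) s t := by
  induction k generalizing i s with
  | zero =>
    obtain rfl : i = 0 := by simpa using hi
    unfold siftUp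
    exact after_pure.2 (hs.rearranged rfl (by simp))
  | succ k ih =>
    unfold siftUp
    split
    · exact after_pure.2 (hs.rearranged rfl (by simp))
    · refine (above_after d _ _ s).bind fun b t ⟨ht, ht'⟩ => ?_
      have h₁ := hs.rearranged ht ht'
      split
      · refine (swapCells_indexed h₁.indexed _ _).bind fun _ u ⟨hu, _⟩ =>
          (ih hu.indexed ?_).mono fun _ v hv => ?_
        · rw [pow_succ] at hi
          omega
        · exact (h₁.trans hu le_rfl).trans hv (by omega)
      · exact after_pure.2 (hs.rearranged ht (by omega))

/-- Passing to a child at least doubles `i + 1`; a level costs two comparisons and one exchange, `4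
+ 4 + 6`. For `k = 0` the cell has no child. -/
theorem siftDown_rearranged {d : Side} {k n i : ℕ} {s : Machine α} (hs : Indexed d s)
    (hi : n ≤ 2 ^ k * (i + 1)) :
    After (siftDown d n i) s fun _ t => Rearranged d (14 * k) s t := by
  induction k generalizing i s with
  | zero =>
    unfold siftDown
    rw [dif_neg (by omega)]
    exact after_pure.2 (hs.rearranged rfl (by simp))
  | succ k ih =>
    unfold siftDown
    split
    · refine (above_after d _ _ s).bind fun b t ⟨ht, ht'⟩ => ?_
      have h₁ := hs.rearranged ht ht'
      refine (above_after d _ _ t).bind fun b' u ⟨hu, hu'⟩ => ?_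
      have h₂ := h₁.indexed.rearranged hu hu'
      split
      · refine (swapCells_indexed h₂.indexed _ _).bind fun _ v ⟨hv, _⟩ =>
          (ih hv.indexed ?_).mono fun _ w hw => ?_
        · calc n ≤ 2 ^ (k + 1) * (i + 1) := hi
            _ = 2 ^ k * (2 * i + 1 + 1) := by ring
            _ ≤ _ := Nat.mul_le_mul_left _ (by omega)
        · exact ((h₁.trans h₂ le_rfl).trans hv le_rfl).trans hw (by omega)
      · exact after_pure.2 (h₁.trans h₂ (by omega))
    · exact after_pure.2 (hs.rearranged rfl (by simp))

theorem restore_rearranged {d : Side} {L i : ℕ} {s : Machine α} (hs : Indexed d s)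
    (hi : i < 2 ^ L) (hL : (s.heap d).size ≤ 2 ^ L) :
    After (restore d i) s fun _ t => Rearranged d (24 * L + 1) s t := by
  refine (siftUp_rearranged hs hi).bind fun _ t ht => ?_
  simp only [after_bind, heapSize, after_elementary]
  have h : Rearranged d 1 t { t with steps := t.steps + 1 } := ht.indexed.rearranged rfl le_rfl
  refine (siftDown_rearranged (k := L) h.indexed ?_).mono fun _ u hu => ?_
  · rw [ht.size]
    exact hL.trans (Nat.le_mul_of_pos_right _ (by omega))
  · exact (ht.trans h le_rfl).trans hu (by omega)

theorem heapInsert_after {d : Side} {M L : ℕ} {p : MPair α} {s : Machine α} (hs : Indexed d s)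
    (hp : s.slot d p = none) (hM : (s.heap d).size < M) (hL : M ≤ 2 ^ L) :
    After (heapInsert M d p) s fun _ t => Indexed d t ∧
      (t.heap d).size = (s.heap d).size + 1 ∧
      (∀ q, (t.slot d q).isSome ↔ q = p ∨ (s.slot d q).isSome) ∧
      t.steps ≤ s.steps + (10 * L + 3) := by
  simp only [heapInsert, after_bind, heapSize, after_elementary, if_pos hM, pushCell, writeSlot]
  refine (siftUp_rearranged (k := L) ?_ (by omega)).mono fun _ t ht => ⟨ht.indexed, ?_, ?_, ?_⟩
  · intro q i
    have := hs q i
    simp only [Function.update_self, Array.getElem?_push]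
    by_cases hq : q = p
    · subst hq
      have := hs q
      grind
    · grind
  · rw [ht.size]
    simp
  · intro q
    rw [ht.isSome]
    by_cases hq : q = p
    · simp [hq]
    · simp [hq]
  · refine ht.steps.trans ?_
    simp only
    omega

theorem heapDelete_after {d : Side} {L i : ℕ} {p : MPair α} {s : Machine α} (hs : Indexed d s)
    (hp : s.slot d p = some i) (hL : (s.heap d).size ≤ 2 ^ L) :
    After (heapDelete d p) s fun _ t => Indexed d t ∧
      (t.heap d).size + 1 = (s.heap d).size ∧
      (∀ q, (t.slot d q).isSome ↔ q ≠ p ∧ (s.slot d q).isSome) ∧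
      t.steps ≤ s.steps + (24 * L + 11) := by
  have hi := hs.lt_size hp
  simp only [heapDelete, after_bind, heapSize, readSlot, after_elementary, hp]
  have h₀ : Rearranged d 2 s { s with steps := s.steps + 1 + 1 } := hs.rearranged rfl le_rfl
  refine (swapCells_indexed h₀.indexed _ _).mono fun _ t ⟨ht, hlast⟩ => ?_
  replace ht := h₀.trans ht le_rfl
  have hlast : (t.heap d)[(s.heap d).size - 1]? = some p :=
    hlast p _ ((hs p i).1 hp) (Array.getElem?_eq_getElem (by simp only; omega))
  have hslot := (ht.indexed p _).2 hlast
  simp only [popCell, writeSlot, after_elementary]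
  -- If `p` was in the last cell, `i` now lies just outside the array; this is harmless, since the
  -- cost bound only needs `i < 2 ^ L`.
  refine (restore_rearranged (L := L) ?_ (by omega) ?_).mono fun _ u hu =>
    ⟨hu.indexed, ?_, ?_, ?_⟩
  · intro q k
    have h := ht.indexed q k
    have hsz := ht.size
    simp only [Function.update_self, Array.getElem?_pop]
    by_cases hq : q = p
    · subst hq
      grind
    · grind
  · simp only [Function.update_self, Array.size_pop, ht.size]
    omega
  · rw [hu.size]
    simp only [Function.update_self, Array.size_pop, ht.size]
    omega
  · intro q
    rw [hu.isSome]
    by_cases hq : q = p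
    · simp [hq]
    · simp [hq, ht.isSome]
  · have := hu.steps
    have := ht.steps
    simp only at *
    omega

/-! ### The priority queue -/

/-- The invariant of the queue of capacity `M`, where `fr` is the frequency by which the pairs are
filed: the two heaps have the same entries, and each other pair with a positive frequency is in the
bucket of that frequency. -/
structure QueueInv (M : ℕ) (fr : MPair α → ℕ) (s : Machine α) : Prop where
  indexed : ∀ d, Indexed d s
  size_le : (s.heap .max).size ≤ M
  size_eq : (s.heap .min).size = (s.heap .max).size
  isSome : ∀ p, (s.slot .min p).isSome ↔ (s.slot .max p).isSome
  of_mem : ∀ p k, p ∈ s.bucket k → ¬ (s.slot .max p).isSome ∧ fr p = k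
  mem : ∀ p, ¬ (s.slot .max p).isSome → 0 < fr p → p ∈ s.bucket (fr p)
  nodup : ∀ k, (s.bucket k).Nodup
  le_bound : ∀ p k, p ∈ s.bucket k → k ≤ s.bound

/-- The heap order is not part of the invariant, so the filed frequency of a pair inside the heaps
is irrelevant. -/
theorem QueueInv.congr {M : ℕ} {fr fr' : MPair α → ℕ} {s : Machine α} (hs : QueueInv M fr s)
    (h : ∀ q, ¬ (s.slot .max q).isSome → fr q = fr' q) : QueueInv M fr' s where
  __ := hs
  of_mem p k hp := by
    obtain ⟨h₁, h₂⟩ := hs.of_mem p k hp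
    exact ⟨h₁, h p h₁ ▸ h₂⟩
  mem p hp h0 := by
    rw [← h p hp] at h0 ⊢
    exact hs.mem p hp h0

theorem QueueInv.of_steps {M : ℕ} {fr : MPair α → ℕ} {s t : Machine α} (hs : QueueInv M fr s)
    (ht : t = { s with steps := t.steps, positions := t.positions, node := t.node,
                       applied := t.applied, out := t.out }) : QueueInv M fr t := by
  rw [ht]
  exact ⟨hs.indexed, hs.size_le, hs.size_eq, hs.isSome, hs.of_mem, hs.mem, hs.nodup, hs.le_bound⟩

/-- Between leaving the heaps and being filed elsewhere, `p` is in no bucket; filing it under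
frequency 0 keeps the invariant true meanwhile. -/
theorem deleteBoth_after {M L : ℕ} {fr : MPair α → ℕ} {s : Machine α} {p : MPair α}
    (hs : QueueInv M fr s) (hp : (s.slot .max p).isSome) (hL : M ≤ 2 ^ L) :
    After (heapDelete .max p) s fun _ t => After (heapDelete .min p) t fun _ u =>
      QueueInv M (Function.update fr p 0) u ∧ (u.heap .max).size < M ∧
      ¬ (u.slot .max p).isSome ∧ u.bucket = s.bucket ∧ u.bound = s.bound ∧
      u.positions = s.positions ∧ u.steps ≤ s.steps + (48 * L + 22) := by
  have hp' := (hs.isSome p).2 hp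
  obtain ⟨i, hi⟩ := Option.isSome_iff_exists.1 hp
  obtain ⟨j, hj⟩ := Option.isSome_iff_exists.1 hp'
  refine ((heapDelete_after (hs.indexed _) hi (hs.size_le.trans hL)).and
    (heapDelete_keeps _ _ _)).mono fun _ t ⟨⟨t₁, t₂, t₃, t₄⟩, t₅⟩ => ?_
  simp only [outsideHeap, Side.other, Prod.mk.injEq] at t₅
  obtain ⟨-, t₅, t₆, t₇, -, t₈, t₉⟩ := t₅
  have ht : Indexed .min t := by
    have := hs.indexed .min
    unfold Indexed at this ⊢
    rwa [t₈, t₉]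
  refine ((heapDelete_after ht (by rw [t₉, hj]) (L := L) ?_).and
    (heapDelete_keeps _ _ _)).mono fun _ u ⟨⟨u₁, u₂, u₃, u₄⟩, u₅⟩ => ?_
  · rw [t₈, hs.size_eq]
    exact hs.size_le.trans hL
  simp only [outsideHeap, Side.other, Prod.mk.injEq] at u₅
  obtain ⟨-, u₅, u₆, u₇, -, u₈, u₉⟩ := u₅
  rw [t₈] at u₂
  have hsz := hs.size_eq
  have hle := hs.size_le
  rw [t₆] at u₆
  refine ⟨⟨?_, ?_, ?_, ?_, ?_, ?_, ?_, ?_⟩, ?_, ?_, u₆, u₇.trans t₇, u₅.trans t₅, by omega⟩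
  · rintro (_ | _)
    · unfold Indexed at t₁ ⊢
      rwa [u₈, u₉]
    · exact u₁
  · rw [u₈]
    omega
  · rw [u₈]
    omega
  · intro q
    rw [u₃, t₉, u₉, t₃, hs.isSome]
  · intro q k hq
    rw [u₆] at hq
    obtain ⟨h₁, h₂⟩ := hs.of_mem q k hq
    have hqp : q ≠ p := by
      rintro rfl
      exact h₁ hp
    rw [u₉, t₃, Function.update_of_ne hqp]
    exact ⟨fun h => h₁ h.2, h₂⟩
  · intro q hq h0
    have hqp : q ≠ p := by
      rintro rfl
      simp at h0
    rw [u₉, t₃] at hq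
    rw [Function.update_of_ne hqp] at h0 ⊢
    rw [u₆]
    exact hs.mem q (fun h => hq ⟨hqp, h⟩) h0
  · rw [u₆]
    exact hs.nodup
  · rw [u₆, u₇, t₇]
    exact hs.le_bound
  · rw [u₈]
    omega
  · rw [u₉, t₃]
    simp

theorem restoreBoth_after {M L i j : ℕ} {fr : MPair α → ℕ} {s : Machine α} {p : MPair α}
    (hs : QueueInv M fr s) (hi : s.slot .max p = some i) (hj : s.slot .min p = some j)
    (hL : M ≤ 2 ^ L) :
    After (restore .max i) s fun _ t => After (restore .min j) t fun _ u =>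
      QueueInv M fr u ∧ (∀ q, (u.slot .max q).isSome = (s.slot .max q).isSome) ∧
      u.bound = s.bound ∧ u.positions = s.positions ∧ u.steps ≤ s.steps + (48 * L + 2) := by
  have hi' := (hs.indexed _).lt_size hi
  have hj' := (hs.indexed _).lt_size hj
  have hsz := hs.size_eq
  have hle := hs.size_le
  refine ((restore_rearranged (hs.indexed _) (by omega) (hs.size_le.trans hL)).and
    (restore_keeps _ _ _)).mono fun _ t ⟨ht, t₅⟩ => ?_
  simp only [outsideHeap, Side.other, Prod.mk.injEq] at t₅
  obtain ⟨-, t₅, t₆, t₇, -, t₈, t₉⟩ := t₅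
  have ht' : Indexed .min t := by
    have := hs.indexed .min
    unfold Indexed at this ⊢
    rwa [t₈, t₉]
  refine ((restore_rearranged ht' (L := L) (by omega) (by rw [t₈]; omega)).and
    (restore_keeps _ _ _)).mono fun _ u ⟨hu, u₅⟩ => ?_
  simp only [outsideHeap, Side.other, Prod.mk.injEq] at u₅
  obtain ⟨-, u₅, u₆, u₇, -, u₈, u₉⟩ := u₅
  rw [t₆] at u₆
  have hmax (q : MPair α) : (u.slot .max q).isSome = (s.slot .max q).isSome := by
    rw [u₉, ht.isSome]
  have hts := ht.steps
  have hus := hu.steps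
  refine ⟨⟨?_, ?_, ?_, ?_, ?_, ?_, ?_, ?_⟩, hmax, u₇.trans t₇, u₅.trans t₅, by omega⟩
  · rintro (_ | _)
    · have := ht.indexed
      unfold Indexed at this ⊢
      rwa [u₈, u₉]
    · exact hu.indexed
  · rw [u₈, ht.size]
    exact hle
  · rw [u₈, ht.size, hu.size, t₈, hsz]
  · intro q
    rw [hu.isSome, t₉, hmax, hs.isSome]
  · intro q k hq
    rw [hmax]
    exact hs.of_mem q k (u₆ ▸ hq)
  · intro q hq h0
    rw [hmax] at hq
    rw [u₆]
    exact hs.mem q hq h0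
  · rw [u₆]
    exact hs.nodup
  · rw [u₆, u₇, t₇]
    exact hs.le_bound

theorem promote_after {M L k : ℕ} {fr : MPair α → ℕ} {s : Machine α} {p : MPair α}
    (hs : QueueInv M fr s) (hp : p ∈ s.bucket k) (hM : (s.heap .max).size < M) (hL : M ≤ 2 ^ L) :
    After (promote M p k) s fun _ t => QueueInv M fr t ∧ t.bound = s.bound ∧
      t.steps ≤ s.steps + (20 * L + 7) := by
  obtain ⟨hp₁, hp₂⟩ := hs.of_mem p k hp
  have hp₁' := mt (hs.isSome p).1 hp₁
  rw [Option.not_isSome_iff_eq_none] at hp₁ hp₁'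
  simp only [promote, after_bind, bucketErase, after_elementary]
  refine ((heapInsert_after (L := L) (s := { s with
      bucket := Function.update s.bucket k ((s.bucket k).erase p), steps := s.steps + 1 })
      (hs.indexed .max) hp₁ hM hL).and
    (heapInsert_keeps _ _ _ _)).mono fun _ t ⟨⟨t₁, t₂, t₃, t₄⟩, t₅⟩ => ?_
  simp only [outsideHeap, Side.other, Prod.mk.injEq] at t₂ t₃ t₄ t₅
  obtain ⟨-, -, t₆, t₇, -, t₈, t₉⟩ := t₅
  have ht' : Indexed .min t := by
    have := hs.indexed .min
    unfold Indexed at this ⊢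
    rwa [t₈, t₉]
  refine ((heapInsert_after (M := M) (L := L) ht' (by rw [t₉, hp₁']) ?_ hL).and
    (heapInsert_keeps _ _ _ _)).mono fun _ u ⟨⟨u₁, u₂, u₃, u₄⟩, u₅⟩ => ?_
  · rw [t₈, hs.size_eq]
    exact hM
  simp only [outsideHeap, Side.other, Prod.mk.injEq] at u₅
  obtain ⟨-, -, u₆, u₇, -, u₈, u₉⟩ := u₅
  rw [t₆] at u₆
  have hsz := hs.size_eq
  -- `p` disappears from all buckets: it was only in the bucket of its filed frequency, and only
  -- once there.
  have hb (q : MPair α) (l : ℕ) : q ∈ u.bucket l ↔ q ≠ p ∧ q ∈ s.bucket l := by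
    rw [u₆]
    by_cases hl : l = k
    · subst hl
      simp [(hs.nodup l).mem_erase_iff]
    · rw [Function.update_of_ne hl]
      refine ⟨fun h => ⟨?_, h⟩, fun h => h.2⟩
      rintro rfl
      exact hl (((hs.of_mem _ _ h).2).symm.trans hp₂)
  refine ⟨⟨?_, ?_, ?_, ?_, ?_, ?_, ?_, ?_⟩, u₇.trans t₇, by omega⟩
  · rintro (_ | _)
    · unfold Indexed at t₁ ⊢
      rwa [u₈, u₉]
    · exact u₁
  · rw [u₈]
    omega
  · rw [u₈, u₂, t₈, t₂, hsz]
  · intro q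
    rw [u₃, t₉, u₉, t₃, hs.isSome]
  · intro q l hq
    rw [hb] at hq
    obtain ⟨h₁, h₂⟩ := hs.of_mem q l hq.2
    rw [u₉, t₃]
    exact ⟨by simp [hq.1, h₁], h₂⟩
  · intro q hq h0
    rw [u₉, t₃, not_or] at hq
    exact (hb _ _).2 ⟨hq.1, hs.mem q hq.2 h0⟩
  · intro l
    rw [u₆]
    by_cases hl : l = k
    · subst hl
      simpa using (hs.nodup l).erase p
    · rw [Function.update_of_ne hl]
      exact hs.nodup l
  · intro q l hq
    rw [u₇, t₇]
    exact hs.le_bound q l ((hb _ _).1 hq).2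

/-- Each empty bucket costs one step and lowers the future `bound` by one, so the length of the scan
cancels in `steps + bound`. The 2 pays for the last head lookup and for writing the bound. -/
theorem bestOutside_after {r : ℕ} {s : Machine α} (hr : ∀ p k, p ∈ s.bucket k → k ≤ r) :
    After (bestOutside r) s fun o t => t = { s with bound := t.bound, steps := t.steps } ∧
      t.steps + t.bound ≤ s.steps + r + 2 ∧ (∀ p k, p ∈ s.bucket k → k ≤ t.bound) ∧
      ∀ p k, o = some (p, k) → p ∈ s.bucket k ∧ k = t.bound := by
  induction r generalizing s with
  | zero =>
    simp only [bestOutside, after_bind, writeBound, after_elementary, after_pure]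
    exact ⟨trivial, by omega, hr, by simp⟩
  | succ r ih =>
    simp only [bestOutside, after_bind, bucketHead, after_elementary]
    split
    next p hp =>
      simp only [after_bind, writeBound, after_elementary, after_pure]
      refine ⟨trivial, by omega, hr, fun q k h => ?_⟩
      simp only [Option.some.injEq, Prod.mk.injEq] at h
      obtain ⟨rfl, rfl⟩ := h
      exact ⟨List.mem_of_mem_head? hp, rfl⟩
    next hnone =>
      rw [List.head?_eq_none_iff] at hnone
      refine (ih fun p k hp => ?_).mono fun o t ⟨h₁, h₂, h₃, h₄⟩ => ⟨h₁, ?_, h₃, h₄⟩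
      · have := hr p k hp
        rcases this.lt_or_eq with h | rfl
        · omega
        · simp [hnone] at hp
      · simp only at h₂
        omega

/-- The frequencies of the pairs. -/
def freq (s : Machine α) (p : MPair α) : ℕ := (s.positions p).length

theorem balance_after {M L : ℕ} {s : Machine α} (hs : QueueInv M (freq s) s) (hL : M ≤ 2 ^ L) :
    After (balance M) s fun _ t => QueueInv M (freq s) t ∧
      t.steps + t.bound ≤ s.steps + s.bound + (68 * L + 36) := by
  simp only [balance, after_bind, readBound, after_elementary]
  refine (bestOutside_after (s := { s with steps := s.steps + 1 }) hs.le_bound).mono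
    fun o t ⟨ht, h₁, h₂, h₃⟩ => ?_
  simp only at h₁ h₂ h₃
  have hinv : QueueInv M (freq s) t := by
    rw [ht]
    exact ⟨hs.indexed, hs.size_le, hs.size_eq, hs.isSome, hs.of_mem, hs.mem, hs.nodup, h₂⟩
  have hb : t.bucket = s.bucket := by rw [ht]
  have hpos : t.positions = s.positions := by rw [ht]
  rw [← hb] at h₃
  clear ht
  split
  · exact after_pure.2 ⟨hinv, by omega⟩
  next p k _ =>
    obtain ⟨hp, hk⟩ := h₃ p k rfl
    simp only [after_bind, heapSize, after_elementary]
    split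
    next hM =>
      refine (promote_after (hinv.of_steps (t := { t with steps := t.steps + 1 }) rfl) hp hM
        hL).mono fun _ u ⟨u₁, u₂, u₃⟩ => ⟨u₁, ?_⟩
      simp only at u₂ u₃
      omega
    · simp only [after_bind, readCell, after_elementary]
      split
      · refine after_pure.2 ⟨hinv.of_steps rfl, ?_⟩
        simp only
        omega
      next q hq =>
        simp only [after_bind, frequency, after_elementary]
        split
        next hg =>
          simp only [after_bind]
          have hq' : (t.slot .max q).isSome := by
            rw [← hinv.isSome, (hinv.indexed .min q 0).2 hq]
            rfl
          refine (deleteBoth_after (hinv.of_steps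
            (t := { t with steps := t.steps + 1 + 1 + 1 }) rfl) hq' hL).mono
            fun _ u hu => hu.mono fun _ v ⟨v₁, v₂, v₃, v₄, v₅, v₆, v₇⟩ => ?_
          simp only at v₄ v₅ v₆ v₇
          simp only [bucketInsert, after_elementary]
          rw [hpos] at hg ⊢
          have hqb (l : ℕ) : q ∉ v.bucket l := fun h => by
            rw [v₄] at h
            exact (hinv.of_mem q l h).1 hq'
          have hmem (r : MPair α) (l : ℕ) : r ∈ Function.update v.bucket (freq s q)
              (q :: v.bucket (freq s q)) l ↔ r ∈ v.bucket l ∨ (r = q ∧ l = freq s q) := by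
            by_cases hl : l = freq s q
            · subst hl
              simp [or_comm]
            · simp [hl]
          refine (promote_after (L := L) (M := M) (fr := freq s) (s := { v with
              bucket := Function.update v.bucket (freq s q) (q :: v.bucket (freq s q)),
              steps := v.steps + 1 }) ⟨v₁.indexed, v₁.size_le, v₁.size_eq, v₁.isSome,
              ?_, ?_, ?_, ?_⟩ ?_ v₂ hL).mono fun _ w ⟨w₁, w₂, w₃⟩ => ⟨w₁, ?_⟩
          · intro r l hr
            rcases (hmem r l).1 hr with hr' | ⟨rfl, rfl⟩
            · have h := v₁.of_mem r l hr'
              rw [Function.update_of_ne] at h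
              · exact h
              · rintro rfl
                exact hqb _ hr'
            · exact ⟨v₃, rfl⟩
          · intro r hr h0
            rw [hmem]
            by_cases hrq : r = q
            · exact .inr ⟨hrq, by rw [hrq]⟩
            · have := v₁.mem r hr
              rw [Function.update_of_ne hrq] at this
              exact .inl (this h0)
          · intro l
            by_cases hl : l = freq s q
            · subst hl
              simpa using ⟨hqb _, v₁.nodup _⟩
            · simpa [hl] using v₁.nodup l
          · intro r l hr
            rcases (hmem r l).1 hr with hr | ⟨rfl, rfl⟩
            · exact v₁.le_bound r l hr
            -- The evicted pair is less frequent than the promoted one, whose frequency equals the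
            -- bound, so the bound need not grow.
            · change freq s r ≤ v.bound
              unfold freq
              omega
          · exact (hmem p k).2 (.inl (v₄ ▸ hp))
          · simp only at w₂ w₃
            omega
        · refine after_pure.2 ⟨hinv.of_steps rfl, ?_⟩
          simp only
          omega

theorem freq_eq_of_outsideQueue {s t : Machine α} (h : outsideQueue t = outsideQueue s) :
    freq t = freq s := by
  simp only [outsideQueue, Prod.mk.injEq] at h
  unfold freq
  rw [h.2.1]

/-- The positions have already changed while `p` is still filed under `k`, hence the separate `fr`.
Since `l ≤ k + 1`, the potential `bound` rises by at most one. The leading constant is 48 for two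
heap deletions or restorations plus 68 for balancing. -/
theorem move_after {M L k l : ℕ} {fr : MPair α → ℕ} {s : Machine α} {p : MPair α}
    (hs : QueueInv M fr s) (hk : fr p = k) (hl : l ≤ k + 1)
    (hfreq : freq s = Function.update fr p l) (hL : M ≤ 2 ^ L) :
    After (move M p k l) s fun _ t => QueueInv M (freq t) t ∧
      t.steps + t.bound ≤ s.steps + s.bound + (116 * L + 70) := by
  suffices h : After (move M p k l) s fun _ t => QueueInv M (freq s) t ∧
      t.steps + t.bound ≤ s.steps + s.bound + (116 * L + 70) from
    (h.and (move_keeps M p k l s)).mono fun _ t ⟨⟨h₁, h₂⟩, h₃⟩ =>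
      ⟨freq_eq_of_outsideQueue h₃ ▸ h₁, h₂⟩
  have hbal {t : Machine α} (hpos : t.positions = s.positions) (ht : QueueInv M (freq s) t)
      (hle : t.steps + t.bound ≤ s.steps + s.bound + (48 * L + 34)) :
      After (balance M) t fun _ u => QueueInv M (freq s) u ∧
        u.steps + u.bound ≤ s.steps + s.bound + (116 * L + 70) := by
    have hf : freq t = freq s := by
      unfold freq
      rw [hpos]
    rw [← hf] at ht ⊢
    exact (balance_after ht hL).mono fun _ u hu => ⟨hu.1, by omega⟩
  simp only [move, after_bind, readSlot, after_elementary]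
  split
  next i j hi hj =>
    have hp : (s.slot .max p).isSome := by rw [hi]; rfl
    have hs' := hs.of_steps (t := { s with steps := s.steps + 1 + 1 }) rfl
    split
    next h0 =>
      refine (deleteBoth_after hs' hp hL).bind
        fun _ u hu => hu.bind fun _ v ⟨v₁, v₂, v₃, v₄, v₅, v₆, v₇⟩ => ?_
      simp only at v₅ v₇
      rw [h0] at hfreq
      exact hbal v₆ (hfreq ▸ v₁) (by omega)
    · refine (restoreBoth_after hs' hi hj hL).bind
        fun _ u hu => hu.bind fun _ v ⟨v₁, v₂, v₃, v₄, v₅⟩ => ?_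
      simp only at v₃ v₅
      refine hbal v₄ (v₁.congr fun q hq => ?_) (by omega)
      rw [hfreq, Function.update_of_ne]
      rintro rfl
      rw [v₂] at hq
      exact hq hp
  next h =>
    have hp : ¬ (s.slot .max p).isSome := fun hp => by
      obtain ⟨i, hi⟩ := Option.isSome_iff_exists.1 hp
      obtain ⟨j, hj⟩ := Option.isSome_iff_exists.1 ((hs.isSome p).2 hp)
      exact h i j hi hj
    -- A pair outside the heaps with `k > 0` lies in bucket `k`, which is below the bound; therefore
    -- `l ≤ s.bound + 1`.
    have hkb : k ≤ s.bound := by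
      rcases Nat.eq_zero_or_pos k with h0 | h0
      · omega
      · exact hs.le_bound p k (hk ▸ hs.mem p hp (by omega))
    have hb (q : MPair α) (m : ℕ) : q ∈ Function.update s.bucket k ((s.bucket k).erase p) m ↔
        q ≠ p ∧ q ∈ s.bucket m := by
      by_cases hm : m = k
      · subst hm
        simp [(hs.nodup m).mem_erase_iff]
      · rw [Function.update_of_ne hm]
        refine ⟨fun hq => ⟨?_, hq⟩, fun hq => hq.2⟩
        rintro rfl
        exact hm (((hs.of_mem _ _ hq).2).symm.trans hk)
    have hnodup (m : ℕ) : (Function.update s.bucket k ((s.bucket k).erase p) m).Nodup := by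
      by_cases hm : m = k
      · subst hm
        simpa using (hs.nodup m).erase p
      · rw [Function.update_of_ne hm]
        exact hs.nodup m
    simp only [after_bind, bucketErase, after_elementary]
    generalize Function.update s.bucket k ((s.bucket k).erase p) = B at hb hnodup
    split
    next h0 =>
      have hmem (q : MPair α) (m : ℕ) : q ∈ Function.update B l (p :: B l) m ↔
          (q ≠ p ∧ q ∈ s.bucket m) ∨ (q = p ∧ m = l) := by
        by_cases hm : m = l
        · subst hm
          simp [or_comm, hb]
        · simp [hm, hb]
      have hinv (b n : ℕ) (hb₁ : s.bound ≤ b) (hb₂ : l ≤ b) : QueueInv M (freq s)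
          { s with bucket := Function.update B l (p :: B l), bound := b, steps := n } := by
        refine ⟨hs.indexed, hs.size_le, hs.size_eq, hs.isSome, ?_, ?_, ?_, ?_⟩
        · intro q m hq
          rcases (hmem q m).1 hq with ⟨hqp, hq⟩ | ⟨rfl, rfl⟩
          · rw [hfreq, Function.update_of_ne hqp]
            exact hs.of_mem q m hq
          · exact ⟨hp, by rw [hfreq, Function.update_self]⟩
        · intro q hq hq0
          rw [hmem]
          by_cases hqp : q = p
          · subst hqp
            exact .inr ⟨rfl, by rw [hfreq, Function.update_self]⟩
          · rw [hfreq, Function.update_of_ne hqp] at hq0 ⊢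
            exact .inl ⟨hqp, hs.mem q hq hq0⟩
        · intro m
          by_cases hm : m = l
          · subst hm
            have : p ∉ B m := fun h => ((hb _ _).1 h).1 rfl
            simpa using ⟨this, hnodup m⟩
          · simpa [hm] using hnodup m
        · intro q m hq
          rcases (hmem q m).1 hq with ⟨-, hq⟩ | ⟨rfl, rfl⟩
          · exact (hs.le_bound q m hq).trans hb₁
          · exact hb₂
      simp only [after_bind, bucketInsert, readBound, after_elementary]
      split
      · simp only [after_bind, writeBound, after_elementary]
        exact hbal rfl (hinv l _ (by omega) le_rfl) (by simp only; omega)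
      · exact hbal rfl (hinv s.bound _ le_rfl (by omega)) (by simp only; omega)
    next h0 =>
      rw [not_not] at h0
      subst h0
      refine hbal rfl ⟨hs.indexed, hs.size_le, hs.size_eq, hs.isSome, ?_, ?_, hnodup, ?_⟩
        (by simp only; omega)
      · intro q m hq
        obtain ⟨hqp, hq⟩ := (hb q m).1 hq
        rw [hfreq, Function.update_of_ne hqp]
        exact hs.of_mem q m hq
      · intro q hq hq0
        have hqp : q ≠ p := by
          rintro rfl
          simp [hfreq] at hq0
        rw [hfreq, Function.update_of_ne hqp] at hq0 ⊢
        exact (hb _ _).2 ⟨hqp, hs.mem q hq hq0⟩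
      · intro q m hq
        exact hs.le_bound q m ((hb q m).1 hq).2

/-! ### Amortized analysis -/

/-- There are at most `T` positions in the memory. -/
def PositionsLE (T : ℕ) (s : Machine α) : Prop :=
  ∀ S : Finset (MPair α), ∑ p ∈ S, freq s p ≤ T

/-- The queue is in order, there are at most `T` positions, and the number of steps together with
the bound for the buckets is at most `E`. -/
structure Budget (M T E : ℕ) (s : Machine α) : Prop where
  queue : QueueInv M (freq s) s
  positions : PositionsLE T s
  steps : s.steps + s.bound ≤ E

theorem Budget.mono {M T E T' E' : ℕ} {s : Machine α} (h : Budget M T E s) (hT : T ≤ T')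
    (hE : E ≤ E') : Budget M T' E' s :=
  ⟨h.queue, fun S => (h.positions S).trans hT, h.steps.trans hE⟩

theorem PositionsLE.congr {T : ℕ} {s t : Machine α} (h : PositionsLE T s)
    (hst : t.positions = s.positions) : PositionsLE T t := by
  intro S
  simpa only [freq, hst] using h S

/-- A program whose run costs only steps spends that many of the budget. -/
theorem Budget.of_steps {M T E E' : ℕ} {s t : Machine α} (h : Budget M T E s)
    (ht : t = { s with steps := t.steps, node := t.node, applied := t.applied, out := t.out })
    (hE : t.steps + E ≤ s.steps + E') : Budget M T E' t := by
  have hp : t.positions = s.positions := by rw [ht]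
  have hb : t.bound = s.bound := by rw [ht]
  have hf : freq t = freq s := by
    unfold freq
    rw [hp]
  refine ⟨?_, h.positions.congr hp, ?_⟩
  · rw [hf]
    refine h.queue.of_steps ?_
    rw [hp]
    exact ht
  · have := h.steps
    omega

theorem freq_update {s t : Machine α} {p : MPair α} {l : List ℕ}
    (ht : t.positions = Function.update s.positions p l) :
    freq t = Function.update (freq s) p l.length := by
  funext q
  by_cases hq : q = p
  · subst hq
    simp [freq, ht]
  · simp [freq, ht, hq]

/-- The cost of a change of the set of positions of a pair. -/
theorem move_budget {M L T T' E n : ℕ} {s : Machine α} {p : MPair α} {l : List ℕ}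
    (hs : Budget M T E s) (hl : l.length ≤ (s.positions p).length + 1) (hL : M ≤ 2 ^ L)
    (hn : n ≤ s.steps + 5)
    (hT : ∀ S : Finset (MPair α), ∑ q ∈ S, Function.update (freq s) p l.length q ≤ T') :
    After (move M p (s.positions p).length l.length)
      { s with positions := Function.update s.positions p l, steps := n }
      fun _ t => Budget M T' (E + (116 * L + 75)) t := by
  set s' : Machine α := { s with positions := Function.update s.positions p l, steps := n } with hs'
  have hf : freq s' = Function.update (freq s) p l.length := freq_update rfl
  have hq : QueueInv M (freq s) s' := hs.queue.of_steps rfl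
  refine ((move_after hq rfl hl hf hL).and (move_keeps M p _ _ s')).mono
    fun _ t ⟨⟨h₁, h₂⟩, h₃⟩ => ⟨h₁, fun S => ?_, ?_⟩
  · rw [freq_eq_of_outsideQueue h₃, hf]
    exact hT S
  · have := hs.steps
    simp only [hs'] at h₂
    omega

/-- Used with `m = 1` for an inserted position and `m = 0` for an erased one. -/
theorem sum_update_le {ι : Type} [DecidableEq ι] {f : ι → ℕ} {i : ι} {n m T : ℕ}
    (hf : ∀ S : Finset ι, ∑ j ∈ S, f j ≤ T) (hn : n ≤ f i + m) (S : Finset ι) :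
    ∑ j ∈ S, Function.update f i n j ≤ T + m := by
  by_cases hi : i ∈ S
  · have h := hf S
    rw [Finset.sum_update_of_mem hi]
    rw [Finset.sum_eq_add_sum_sdiff_singleton_of_mem hi] at h
    omega
  · rw [Finset.sum_update_of_notMem hi]
    exact (hf S).trans (Nat.le_add_right _ _)

theorem sum_update_zero_add_le {ι : Type} [DecidableEq ι] {f : ι → ℕ} {i : ι} {T : ℕ}
    (hf : ∀ S : Finset ι, ∑ j ∈ S, f j ≤ T) (S : Finset ι) :
    ∑ j ∈ S, Function.update f i 0 j + f i ≤ T := by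
  by_cases hi : i ∈ S
  · have h := hf S
    rw [Finset.sum_update_of_mem hi]
    rw [Finset.sum_eq_add_sum_sdiff_singleton_of_mem hi] at h
    omega
  · have h := hf (insert i S)
    rw [Finset.sum_insert hi] at h
    rw [Finset.sum_update_of_notMem hi]
    omega

theorem addPosition_budget {M L T E : ℕ} (u v : Option ℕ) {s : Machine α} (hs : Budget M T E s)
    (hL : M ≤ 2 ^ L) :
    After (addPosition M u v) s fun _ t => Budget M (T + 1) (E + (116 * L + 75)) t := by
  unfold addPosition
  split
  · simp only [after_bind, readNode, after_elementary]
    split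
    next a b ha hb =>
      simp only [after_bind, frequency, insertPos, after_elementary, Function.update_self]
      exact move_budget hs (by simp) hL le_rfl (sum_update_le hs.positions (by simp [freq]))
    · exact after_pure.2 ((hs.of_steps rfl (by simp only; omega)).mono (Nat.le_succ _) le_rfl)
  · exact after_pure.2 (hs.mono (Nat.le_succ _) (by omega))

theorem removePosition_budget {M L T E : ℕ} (u v : Option ℕ) {s : Machine α}
    (hs : Budget M T E s) (hL : M ≤ 2 ^ L) :
    After (removePosition M u v) s fun _ t => Budget M T (E + (116 * L + 75)) t := by
  unfold removePosition
  split
  · simp only [after_bind, readNode, after_elementary]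
    split
    next a b ha hb =>
      simp only [after_bind, frequency, erasePos, after_elementary, Function.update_self]
      exact move_budget hs (List.length_erase_le.trans (Nat.le_succ _)) hL le_rfl
        (sum_update_le (m := 0) hs.positions List.length_erase_le)
    · exact after_pure.2 (hs.of_steps rfl (by simp only; omega))
  · exact after_pure.2 (hs.mono le_rfl (by omega))

/-- The detached positions leave the count `T`, which is what releases their credits in the main
loop. -/
theorem top_budget {M L T E : ℕ} {s : Machine α} (hs : Budget M T E s) (hL : M ≤ 2 ^ L) :
    After (top M) s fun o t => ∃ T', Budget M T' (E + (116 * L + 75)) t ∧ T' ≤ T ∧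
      ∀ p l, o = some (p, l) → T' + l.length ≤ T := by
  simp only [top, after_bind, readCell, after_elementary]
  split
  · exact after_pure.2 ⟨T, hs.of_steps rfl (by simp only; omega), le_rfl, by simp⟩
  next p hp =>
    simp only [after_bind]
    have hp' : (s.slot .max p).isSome := by
      rw [(hs.queue.indexed .max p 0).2 hp]
      rfl
    refine (deleteBoth_after (hs.queue.of_steps (t := { s with steps := s.steps + 1 }) rfl)
      hp' hL).mono fun _ u hu => hu.mono fun _ v ⟨v₁, v₂, v₃, v₄, v₅, v₆, v₇⟩ => ?_
    simp only at v₅ v₆ v₇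
    simp only [takePos, after_elementary]
    set w : Machine α := { v with positions := Function.update v.positions p [],
                                  steps := v.steps + 1 } with hw
    have hf : freq w = Function.update (freq s) p 0 :=
      freq_update (l := []) (by simp only [hw, v₆])
    have hwq : QueueInv M (freq w) w := by
      rw [hf]
      exact v₁.of_steps rfl
    have hE := hs.steps
    refine ((balance_after hwq hL).and (balance_keeps M w)).mono fun _ t ⟨⟨h₁, h₂⟩, h₃⟩ =>
      after_pure.2 ⟨T - freq s p, ⟨?_, fun S => ?_, ?_⟩, Nat.sub_le _ _, ?_⟩
    · rw [freq_eq_of_outsideQueue h₃]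
      exact h₁
    · rw [freq_eq_of_outsideQueue h₃, hf]
      exact Nat.le_sub_of_add_le (sum_update_zero_add_le hs.positions S)
    · simp only [hw] at h₂
      omega
    · rintro _ _ ⟨rfl, rfl⟩
      -- The empty set gives `freq s p ≤ T`, so the subtraction `T - freq s p` is not truncated.
      have := sum_update_zero_add_le (i := p) hs.positions ∅
      rw [v₆]
      simp only [freq] at this ⊢
      omega

/-- A merge at one position either is skipped, which takes at most two steps, or is applied. -/
theorem applyAt_budget {M L T E : ℕ} (p : MPair α) (w : ℕ) {s : Machine α} (hs : Budget M T E s)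
    (hL : M ≤ 2 ^ L) :
    After (applyAt M p w) s fun _ t =>
      (t.applied = s.applied ∧ Budget M T (E + 2) t) ∨
      (t.applied = s.applied + 1 ∧ Budget M (T + 2) (E + (464 * L + 306)) t) := by
  have hskip (n : ℕ) (hn : n ≤ s.steps + 2) : Budget M T (E + 2) { s with steps := n } :=
    hs.of_steps rfl (by simp only; omega)
  -- Before the two additions: two removals at `116 * L + 75` each and at most six reads and writes
  -- of nodes.
  have hadd (u v u' v' : Option ℕ) (t : Machine α) (ha : t.applied = s.applied + 1)
      (ht : Budget M T (E + (232 * L + 156)) t) :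
      After (addPosition M u v >>= fun _ => addPosition M u' v') t fun _ t =>
        (t.applied = s.applied ∧ Budget M T (E + 2) t) ∨
        (t.applied = s.applied + 1 ∧ Budget M (T + 2) (E + (464 * L + 306)) t) :=
    ((addPosition_budget u v ht hL).and (addPosition_keeps M u v t)).bind fun _ t₁ ⟨h₁, h₁'⟩ =>
      ((addPosition_budget u' v' h₁ hL).and (addPosition_keeps M u' v' t₁)).mono
        fun _ t₂ ⟨h₂, h₂'⟩ => .inr ⟨by
          simp only [listPart, Prod.mk.injEq] at h₁' h₂'
          rw [h₂'.2, h₁'.2, ha], h₂.mono le_rfl (by omega)⟩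
  simp only [applyAt, after_bind, readNode, after_elementary]
  split
  next a ha =>
    split
    next v hv =>
      simp only [after_bind, after_elementary]
      split
      next b hb =>
        split
        · rw [after_bind, after_countApplication]
          have h₀ : Budget M T (E + 2) { s with steps := s.steps + 1 + 1,
                                                applied := s.applied + 1 } :=
            hs.of_steps rfl (by simp only; omega)
          refine ((removePosition_budget _ _ h₀ hL).and (removePosition_keeps M _ _ _)).bind
            fun _ s₁ ⟨h₁, h₁'⟩ =>
            ((removePosition_budget _ _ h₁ hL).and (removePosition_keeps M _ _ _)).bind
            fun _ s₂ ⟨h₂, h₂'⟩ => ?_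
          replace h₂' : s₂.applied = s.applied + 1 := by
            simp only [listPart, Prod.mk.injEq] at h₁' h₂'
            rw [h₂'.2, h₁'.2]
          simp only [after_bind, writeNode, after_elementary]
          split
          next z hz =>
            simp only [after_bind, after_elementary]
            split
            · simp only [after_bind, after_elementary]
              rw [← after_bind]
              exact hadd _ _ _ _ _ h₂' (h₂.of_steps rfl (by simp only; omega))
            · exact hadd _ _ _ _ _ h₂' (h₂.of_steps rfl (by simp only; omega))
          · exact hadd _ _ _ _ _ h₂' (h₂.of_steps rfl (by simp only; omega))
        · exact after_pure.2 (.inl ⟨rfl, hskip _ le_rfl⟩)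
      · exact after_pure.2 (.inl ⟨rfl, hskip _ le_rfl⟩)
    · exact after_pure.2 (.inl ⟨rfl, hskip _ (by omega)⟩)
  · exact after_pure.2 (.inl ⟨rfl, hskip _ (by omega)⟩)

/-! ### Credits along the main loop -/

/-- The state of the amortized account when an operation on the queue costs at most `K`: each
position in the memory holds a credit for its later visit, each application pays for itself, and
`D` more credits are available. -/
def Account (M K D B : ℕ) (s : Machine α) : Prop :=
  ∃ T E, Budget M T E s ∧ E + (K + 3) * T + D ≤ B + (6 * K + 12) * s.applied

/-- An application costs `4 * K + 6` and must endow two new positions with `K + 3` credits each, in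
all `6 * K + 12`. A skip is covered by the 2 added to `B`. -/
theorem applyAt_account {M L D B : ℕ} (p : MPair α) (w : ℕ) {s : Machine α}
    (hs : Account M (116 * L + 75) D B s) (hL : M ≤ 2 ^ L) :
    After (applyAt M p w) s fun _ t => Account M (116 * L + 75) D (B + 2) t := by
  obtain ⟨T, E, hb, hE⟩ := hs
  refine (applyAt_budget p w hb hL).mono fun _ t ht => ?_
  rcases ht with ⟨ha, ht⟩ | ⟨ha, ht⟩
  · exact ⟨_, _, ht, by rw [ha]; omega⟩
  · refine ⟨_, _, ht, ?_⟩
    rw [ha]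
    generalize hK : 116 * L + 75 = K at *
    have h : 464 * L + 306 = 4 * K + 6 := by omega
    rw [h]
    linarith

theorem forM_applyAt_account {M L D B : ℕ} (p : MPair α) (l : List ℕ) {s : Machine α}
    (hs : Account M (116 * L + 75) D B s) (hL : M ≤ 2 ^ L) :
    After (l.forM (applyAt M p)) s
      fun _ t => Account M (116 * L + 75) D (B + 2 * l.length) t := by
  induction l generalizing s B with
  | nil => exact hs
  | cons w l ih =>
    change After (applyAt M p w >>= fun _ => l.forM (applyAt M p)) s _
    refine (applyAt_account p w hs hL).bind fun _ t ht => ?_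
    have h : B + 2 * (w :: l).length = B + 2 + 2 * l.length := by
      rw [List.length_cons]
      ring
    rw [h]
    exact ih ht

/-- Each iteration that continues is financed by the positions it detaches, so `B` does not grow
with `k`. The extra `K` pays for the last call of `top` when it ends the loop. -/
theorem mainLoop_account {M L B : ℕ} (k : ℕ) {s : Machine α}
    (hs : Account M (116 * L + 75) 0 B s) (hL : M ≤ 2 ^ L) :
    After (mainLoop M k) s
      fun _ t => Account M (116 * L + 75) 0 (B + (116 * L + 75)) t := by
  induction k generalizing s with
  | zero =>
    obtain ⟨T, E, hb, hE⟩ := hs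
    exact after_pure.2 ⟨T, E, hb, by omega⟩
  | succ k ih =>
    obtain ⟨T, E, hb, hE⟩ := hs
    refine ((top_budget hb hL).and (top_keeps M s)).bind fun o t ⟨⟨T', ht, hT, hl⟩, hk⟩ => ?_
    have ha : t.applied = s.applied := (Prod.mk.inj hk).2
    rw [← ha] at hE
    generalize hK : 116 * L + 75 = K at *
    split
    next p w ws _ =>
      have hacc : Account M (116 * L + 75) ((K + 3) * (w :: ws).length) (B + K) t := by
        rw [hK]
        have h := Nat.mul_le_mul_left (K + 3) (hl p _ rfl)
        exact ⟨_, _, ht, by linarith⟩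
      refine (forM_applyAt_account p (w :: ws) hacc hL).bind fun _ u ⟨T₁, E₁, hu, hE₁⟩ => ?_
      rw [hK] at hE₁
      simp only [after_bind, emit, after_elementary]
      refine ih ⟨T₁, E₁ + 1, hu.of_steps rfl (by simp only; omega), ?_⟩
      simp only [List.length_cons] at hE₁ ⊢
      -- With `n ≥ 1` detached positions, `(K + 3) * n ≥ K + 2 * n + 1`: the top, the visits and the
      -- output.
      nlinarith [Nat.zero_le (K * ws.length)]
    · refine after_pure.2 ⟨_, _, ht, ?_⟩
      have h := Nat.mul_le_mul_left (K + 3) hT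
      linarith

/-! ### Cost of initialization and of the whole run -/

theorem forM_addPosition_budget {M L T E : ℕ} (l : List ℕ) {s : Machine α} (hs : Budget M T E s)
    (hL : M ≤ 2 ^ L) :
    After (l.forM fun i => addPosition M (some i) (some (i + 1))) s
      fun _ t => Budget M (T + l.length) (E + (116 * L + 75) * l.length) t := by
  induction l generalizing s T E with
  | nil => exact hs
  | cons w l ih =>
    change After (addPosition M (some w) (some (w + 1)) >>= fun _ => l.forM _) s _
    refine (addPosition_budget _ _ hs hL).bind fun _ t ht => (ih ht).mono fun _ u hu =>
      hu.mono ?_ ?_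
    · rw [List.length_cons]
      omega
    · rw [List.length_cons]
      linarith

theorem budget_empty (M : ℕ) : Budget M 0 0 (empty : Machine α) where
  queue := by constructor <;> simp [empty, Indexed, freq]
  positions S := by simp [freq, empty]
  steps := le_rfl

theorem steps_run_le {M L : ℕ} (x : List α) (hx : 1 ≤ x.length) (hL : M ≤ 2 ^ L) :
    (run M x).steps ≤ x.length * (1044 * L + 691) := by
  have h : After (fasterBPE M x) empty fun _ t => Account M (116 * L + 75) 0
      (x.length * (2 * (116 * L + 75) + 4) + (116 * L + 75)) t := by
    refine (buildList_after x 0 empty).bind fun _ s₁ h₁ => ?_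
    have hb₁ : Budget M 0 x.length s₁ := by
      generalize s₁.node = g at h₁
      subst h₁
      exact (budget_empty M).of_steps rfl (by simp only; omega)
    refine (forM_addPosition_budget _ hb₁ hL).bind fun _ s₂ h₂ => ?_
    -- Initialization takes `N` steps for the list; each of the `N - 1` positions costs `K` to add
    -- and receives `K + 3` credits. Together this is at most `N * (2 * K + 4)`.
    refine mainLoop_account M ⟨_, _, h₂, ?_⟩ hL
    rw [List.length_range]
    obtain ⟨n, hn⟩ := Nat.exists_eq_add_of_le' hx
    rw [hn, Nat.add_sub_cancel]
    generalize 116 * L + 75 = K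
    refine le_trans ?_ (Nat.le_add_right _ _)
    linarith
  obtain ⟨T, E, hb, hE⟩ := h
  have h₁ : (run M x).steps ≤ E := (Nat.le_add_right _ _).trans hb.steps
  have h₂ := applied_run_le M x
  change E + _ + 0 ≤ _ + _ * (run M x).applied at hE
  have h₃ : (run M x).applied ≤ x.length := by omega
  have h₄ := Nat.mul_le_mul_left (6 * (116 * L + 75) + 12) h₃
  -- The single final `K` is at most `N * K`. Per character: `(2 * K + 4) + K + (6 * K + 12) = 9 * K
  -- + 16 = 1044 * L + 691`.
  have h₅ := Nat.mul_le_mul_left (116 * L + 75) hx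
  have h₆ := Nat.zero_le ((116 * L + 75 + 3) * T)
  linarith

end Machine

/-! ### From binary to natural logarithms -/

theorem theorem2 :
    (∀ (α : Type) [DecidableEq α] (x : List α) (M : ℕ),
      (Machine.run M x).applied ≤ x.length - 1) ∧
    ∃ C : ℝ, ∀ (α : Type) [DecidableEq α] (x : List α) (M : ℕ), 1 ≤ x.length → 2 ≤ M →
      ((Machine.run M x).steps : ℝ) ≤ C * ((x.length : ℝ) * Real.log (M : ℝ)) := by
  -- Take `L = l + 1` with `l = Nat.log 2 M`. As `M ≥ 2` gives `l ≥ 1`, the constant terms are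
  -- absorbed: `1044 * (l + 1) + 691 ≤ (1044 + 1735) * l`.
  refine ⟨fun α _ x M => Machine.applied_run_le M x, 2779 / Real.log 2, fun α _ x M hx hM => ?_⟩
  have hM0 : M ≠ 0 := by omega
  have h := Machine.steps_run_le x hx (Nat.lt_pow_succ_log_self one_lt_two M).le
  have hlog : 1 ≤ Nat.log 2 M := Nat.log_pos one_lt_two hM
  generalize hl : Nat.log 2 M = l at h hlog
  have h₁ : (Machine.run M x).steps ≤ 2779 * (x.length * l) := by
    have := Nat.mul_le_mul_left x.length (show 1044 * (l + 1) + 691 ≤ 2779 * l by omega)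
    linarith
  have h₂ : (l : ℝ) * Real.log 2 ≤ Real.log M := by
    rw [← Real.log_pow]
    refine Real.log_le_log (by positivity) ?_
    rw [← hl]
    exact_mod_cast Nat.pow_log_le_self 2 hM0
  have h2 : 0 < Real.log 2 := Real.log_pos one_lt_two
  have h₃ : ((Machine.run M x).steps : ℝ) ≤ 2779 * (x.length * l) := by exact_mod_cast h₁
  refine h₃.trans ?_
  rw [div_mul_eq_mul_div, le_div_iff₀ h2]
  have := mul_le_mul_of_nonneg_left h₂ (Nat.cast_nonneg (α := ℝ) x.length)
  linarith
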